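/- Fix integers $t \ge 1$ and $d \ge 0$, and let $k$ be an integer or $k=\infty$, with $d < k \le \infty$. For $n \ge 0$ let $\mathcal S_{d,k}(n)$ be the set of all binary strings of length $n$ that are concatenations of blocks $0^j1$ with $d \le j \le k$, $j<\infty$. For $x \in \mathcal S_{d,k}(n)$ with exactly $W$ ones, let $\bar x_1 < \dots < \bar x_W$ be the positions of the ones in $x$. For $x, y\in \mathcal S_{d,k}(n)$ with the same number $W$ of ones put $$ d_{\mathrm a}(x,y) = \max\Big\{ \sum_{i=1}^W (\bar x_i - \bar y_i)^+ ,\ \sum_{i=1}^W (\bar x_i - \bar y_i)^- \Big\}, $$ where $a^+=\max\{a,0\}$ and $a^-=\max\{-a,0\}$, and put $d_{\mathrm a}(x,y)=\infty$ if the numbers of ones in $x$ and $y$ differ. Let $M^{\mathrm a}_{d,k}(n;t)$ be the largest cardinality of a code $\mathcal C \subseteq \mathcal S_{d,k}(n)$ with minimum distance larger than $t$, i.e. such that $d_{\mathrm a}(x,y) > t$ for all distinct $x,y \in \mathcal C$. Then the equation $\sum_{i=d+1}^{k+1} x^i = 1$ (a convergent infinite series if $k=\infty$) has a unique positive solution $\rho$,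 and, as $n \to \infty$, $$ \log_2 M^{\mathrm a}_{d,k}(n;t) = -n \log_2 \rho - t \log_2 n + \mathcal O(1), $$ where the implied constant may depend on $d$, $k$ and $t$. -/

import Mathlib

open Filter Asymptotics

/-- The blocks `0^j 1` with `d ≤ j ≤ k` (`j` a natural number, `k` possibly infinite), as a
language over the alphabet `Bool` (`false` is the symbol 0 and `true` is the symbol 1). -/
def runBlocks (d : ℕ) (k : ℕ∞) : Language Bool :=
  {w | ∃ j : ℕ, d ≤ j ∧ (j : ℕ∞) ≤ k ∧ w = List.replicate j false ++ [true]}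

/-- The code space `{0,1}^n ∩ {0^d 1, …, 0^k 1}^*`: binary strings of length `n` that are
concatenations of blocks `0^j 1`, `d ≤ j ≤ k`. -/
def codeSpace (d : ℕ) (k : ℕ∞) (n : ℕ) : Set (List Bool) :=
  {x | x.length = n ∧ x ∈ KStar.kstar (runBlocks d k)}

/-- The Hamming weight of a binary string. -/
def hammingWeight (x : List Bool) : ℕ := x.count true

/-- The position (counted from 1) in `x` of the `1` with index `i`, where the ones of `x` are
indexed by `i = 0, …, hammingWeight x - 1` from left to right. It is only used for these `i`. -/
def onePos (x : List Bool) (i : ℕ) : ℤ := ((x.idxsOf true 1).getD i 0 : ℕ)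

/-- The asymmetric distance: the maximum of the sums of the positive parts and of the negative
parts of the differences of the positions of corresponding ones, for strings of the same weight;
`∞` for strings of different weights. (`Int.toNat` is the positive part.) -/
def asymDist (x y : List Bool) : ℕ∞ :=
  if hammingWeight x = hammingWeight y then
    ((max (∑ i ∈ Finset.range (hammingWeight x), (onePos x i - onePos y i).toNat)
        (∑ i ∈ Finset.range (hammingWeight x), (onePos y i - onePos x i).toNat) : ℕ) : ℕ∞)
  else ⊤

/-- The minimum distance of a code: the minimum of the asymmetric distance over all pairs of
different codewords (`∞` if there is no such pair). -/
noncomputable def minAsymDist (C : Set (List Bool)) : ℕ∞ :=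
  ⨅ (x ∈ C) (y ∈ C) (_ : x ≠ y), asymDist x y

/-- The cardinalities of the codes in the code space with minimum asymmetric distance larger
than `t`. -/
def codeSizes (d : ℕ) (k : ℕ∞) (n t : ℕ) : Set ℕ :=
  {m | ∃ C : Finset (List Bool),
    (C : Set (List Bool)) ⊆ codeSpace d k n ∧ (t : ℕ∞) < minAsymDist (C : Set (List Bool)) ∧
      C.card = m}

/-- The cardinality of an optimal (i.e. largest) code in the code space with minimum asymmetric
distance larger than `t`. -/
noncomputable def optimalCodeSize (d : ℕ) (k : ℕ∞) (n t : ℕ) : ℕ :=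
  sSup (codeSizes d k n t)

/-- The supremum in the definition of `optimalCodeSize` is a maximum. -/
theorem isGreatest_optimalCodeSize (d : ℕ) (k : ℕ∞) (n t : ℕ) :
    IsGreatest (codeSizes d k n t) (optimalCodeSize d k n t) := by
  have hne : (codeSizes d k n t).Nonempty := ⟨0, ∅, by simp, by simp [minAsymDist], rfl⟩
  have hfin : (codeSpace d k n).Finite :=
    (List.finite_length_eq Bool n).subset fun x hx => hx.1
  have hb : BddAbove (codeSizes d k n t) := by
    refine ⟨hfin.toFinset.card, ?_⟩
    rintro m ⟨C, hC, -, rfl⟩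
    exact Finset.card_le_card fun x hx => hfin.mem_toFinset.2 (hC hx)
  exact ⟨Nat.sSup_mem hne hb, fun m hm => le_csSup hb hm⟩

/-- `x` is a positive solution of the characteristic equation `∑_{i=d+1}^{k+1} x^i = 1`
(an infinite, convergent sum if `k = ∞`). -/
def IsCharRoot (d : ℕ) (k : ℕ∞) (x : ℝ) : Prop :=
  0 < x ∧ HasSum (fun i : {i : ℕ // d + 1 ≤ i ∧ (i : ℕ∞) ≤ k + 1} => x ^ (i : ℕ)) 1

/-! A codeword is a list of block lengths, and its ones sit at the partial sums. With `ρ` the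
characteristic root, the number of codewords of length `n` is of exact order `ρ ^ (-n)`
(`card_partLists_mul_pow_le`, `exists_le_card_partLists_mul_pow`). It remains to see that an optimal
code occupies a fraction of exact order `n ^ (-t)`.

Lower bound (`card_partLists_le`): give the `i`-th one the factor `1 - (i + 1) X` over `ZMod p`,
raised to its position. Words of equal weight at distance at most `t` whose products agree modulo `X
^ (t + 1)` are equal, so the `t` coefficients after the constant one split the space into at most `p
^ t` codes. Bertrand's postulate supplies a prime with `n < p ≤ 2 n`.

Upper bound (`optimalCodeSize_mul_choose_le`): swapping consecutive blocks of lengths `a`, `a + 1`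
moves a single one one step to the right. A word with at least `m` such pairs in disjoint slots has
at least `m.choose t` images under `t` swaps, and different codewords share no image. Words with
fewer than `n / q` pairs are exponentially rare, by a generating function in which each pair has
weight `1 / 2` (`sum_ascents_mul_pow_le`). -/

/-! ### Words and their block lengths -/

/-- The lengths of the blocks `0^j 1`, `d ≤ j ≤ k`. -/
def blockLengths (d : ℕ) (k : ℕ∞) : Set ℕ := {i | d + 1 ≤ i ∧ (i : ℕ∞) ≤ k + 1}

/-- The word made of the blocks `0^(i-1) 1`, where `i` runs through the list `l`. -/
def runWord (l : List ℕ) : List Bool :=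
  l.flatMap fun i => List.replicate (i - 1) false ++ [true]

/-- The partial sums of the list `l`, increased by `c`. -/
def partialSums : ℕ → List ℕ → List ℕ
  | _, [] => []
  | c, i :: l => (c + i) :: partialSums (c + i) l

@[simp] theorem length_partialSums (c : ℕ) (l : List ℕ) :
    (partialSums c l).length = l.length := by
  induction l generalizing c with
  | nil => rfl
  | cons i l ih => simp [partialSums, ih]

theorem partialSums_injective (c : ℕ) : Function.Injective (partialSums c) := by
  intro l m h
  induction l generalizing c m with
  | nil => cases m with
    | nil => rfl
    | cons j m => simp [partialSums] at h
  | cons i l ih => cases m with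
    | nil => simp [partialSums] at h
    | cons j m =>
      simp only [partialSums, List.cons.injEq, Nat.add_left_cancel_iff] at h
      obtain ⟨rfl, h⟩ := h
      rw [ih _ h]

theorem idxsOf_block (j s : ℕ) :
    (List.replicate j false ++ [true]).idxsOf true s = [j + s] := by
  induction j generalizing s with
  | zero => simp
  | succ j ih =>
    rw [List.replicate_succ, List.cons_append, List.idxsOf_cons]
    simp only [beq_true, Bool.false_eq_true, if_false, ih]
    congr 1; omega

/-- Each block ends in its only one. The start index exceeds `c` by one because positions are
counted from 1. -/
theorem idxsOf_runWord (l : List ℕ) (hl : ∀ i ∈ l, 0 < i) (c : ℕ) :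
    (runWord l).idxsOf true (c + 1) = partialSums c l := by
  induction l generalizing c with
  | nil => rfl
  | cons i l ih =>
    have hi : 0 < i := hl i (by simp)
    have h := ih (fun j hj => hl j (by simp [hj])) (c + i)
    rw [runWord, List.flatMap_cons, List.idxsOf_append, idxsOf_block, partialSums,
      List.singleton_append]
    congr 1
    · omega
    · rw [← h, runWord]
      congr 1
      simp; omega

theorem length_runWord (l : List ℕ) (hl : ∀ i ∈ l, 0 < i) : (runWord l).length = l.sum := by
  induction l with
  | nil => rfl
  | cons i l ih =>
    have hi : 0 < i := hl i (by simp)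
    have h := ih (fun j hj => hl j (by simp [hj]))
    rw [runWord] at h ⊢
    rw [List.flatMap_cons, List.length_append, h]
    simp; omega

theorem hammingWeight_runWord (l : List ℕ) : hammingWeight (runWord l) = l.length := by
  induction l with
  | nil => rfl
  | cons i l ih =>
    rw [hammingWeight, runWord] at *
    rw [List.flatMap_cons, List.count_append, ih]
    simp [List.count_replicate]; omega

theorem onePos_runWord (l : List ℕ) (hl : ∀ i ∈ l, 0 < i) (i : ℕ) :
    onePos (runWord l) i = ((partialSums 0 l).getD i 0 : ℕ) := by
  rw [onePos, ← idxsOf_runWord l hl 0]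

/-- The positions of the ones recover the partial sums. Positivity matters: by truncated
subtraction, lengths 0 and 1 give the same block. -/
theorem runWord_injOn : Set.InjOn runWord {l | ∀ i ∈ l, 0 < i} := by
  intro l hl m hm h
  apply partialSums_injective 0
  rw [← idxsOf_runWord l hl, ← idxsOf_runWord m hm, h]

/-- The sum of the differences `u_i - v_i` that are positive. -/
def excess (u v : List ℕ) : ℕ := ∑ i ∈ Finset.range u.length, (u.getD i 0 - v.getD i 0)

theorem asymDist_runWord (l m : List ℕ) (hl : ∀ i ∈ l, 0 < i) (hm : ∀ i ∈ m, 0 < i)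
    (h : l.length = m.length) :
    asymDist (runWord l) (runWord m) = (max (excess (partialSums 0 l) (partialSums 0 m))
      (excess (partialSums 0 m) (partialSums 0 l)) : ℕ) := by
  rw [asymDist, if_pos (by simp [hammingWeight_runWord, h])]
  simp only [hammingWeight_runWord, onePos_runWord l hl, onePos_runWord m hm, excess,
    length_partialSums, ← h, Int.toNat_sub]

theorem asymDist_runWord_of_ne (l m : List ℕ) (h : l.length ≠ m.length) :
    asymDist (runWord l) (runWord m) = ⊤ := by
  rw [asymDist, if_neg (by simpa [hammingWeight_runWord] using h)]

theorem pos_of_mem_blockLengths {d : ℕ} {k : ℕ∞} {i : ℕ} (h : i ∈ blockLengths d k) : 0 < i :=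
  (Nat.succ_pos d).trans_le h.1

/-- The finite set of all lists with sum `n` whose members are positive and belong to `A`. -/
noncomputable def partLists (A : Set ℕ) (n : ℕ) : Finset (List ℕ) := by
  classical
  exact ((Finset.univ : Finset (Composition n)).image Composition.blocks).filter
    fun l => ∀ i ∈ l, i ∈ A

theorem mem_partLists {A : Set ℕ} {n : ℕ} {l : List ℕ} :
    l ∈ partLists A n ↔ (∀ i ∈ l, i ∈ A) ∧ (∀ i ∈ l, 0 < i) ∧ l.sum = n := by
  classical
  simp only [partLists, Finset.mem_filter, Finset.mem_image, Finset.mem_univ, true_and]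
  constructor
  · rintro ⟨⟨c, rfl⟩, h⟩
    exact ⟨h, fun i hi => c.blocks_pos hi, c.blocks_sum⟩
  · rintro ⟨h, h0, hs⟩
    exact ⟨⟨⟨l, fun {i} hi => h0 i hi, hs⟩, rfl⟩, h⟩

theorem mem_codeSpace_iff {d : ℕ} {k : ℕ∞} {n : ℕ} {x : List Bool} :
    x ∈ codeSpace d k n ↔ ∃ l ∈ partLists (blockLengths d k) n, runWord l = x := by
  constructor
  · rintro ⟨hx, L, rfl, hL⟩
    have hL' : ∀ L : List (List Bool), (∀ y ∈ L, y ∈ runBlocks d k) →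
        ∃ l : List ℕ, (∀ i ∈ l, i ∈ blockLengths d k) ∧ runWord l = L.flatten := by
      intro L hL
      induction L with
      | nil => exact ⟨[], by simp, rfl⟩
      | cons w L ih =>
        obtain ⟨l, h, h'⟩ := ih fun y hy => hL y (by simp [hy])
        obtain ⟨j, h1, h2, rfl⟩ := hL w (by simp)
        refine ⟨(j + 1) :: l, ?_, ?_⟩
        · intro i hi
          rcases List.mem_cons.1 hi with rfl | hi
          · refine ⟨by omega, ?_⟩
            push_cast
            gcongr
          · exact h i hi
        · rw [runWord, List.flatMap_cons, ← runWord, h']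
          simp
    obtain ⟨l, h, h'⟩ := hL' L hL
    have h0 : ∀ i ∈ l, 0 < i := fun i hi => pos_of_mem_blockLengths (h i hi)
    refine ⟨l, mem_partLists.2 ⟨h, h0, ?_⟩, h'⟩
    rw [← length_runWord l h0, h', hx]
  · rintro ⟨l, hl, rfl⟩
    obtain ⟨h, h0, hs⟩ := mem_partLists.1 hl
    refine ⟨by rw [length_runWord l h0, hs],
      l.map fun i => List.replicate (i - 1) false ++ [true], ?_, ?_⟩
    · rw [runWord, List.flatMap_def]
    · intro y hy
      obtain ⟨i, hi, rfl⟩ := List.mem_map.1 hy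
      obtain ⟨h1, h2⟩ := h i hi
      refine ⟨i - 1, by omega, ?_, rfl⟩
      obtain ⟨i, rfl⟩ := Nat.exists_eq_add_of_lt (h0 i hi)
      push_cast at h2
      simpa using h2

theorem lt_minAsymDist_iff {C : Set (List Bool)} {t : ℕ} :
    (t : ℕ∞) < minAsymDist C ↔ ∀ x ∈ C, ∀ y ∈ C, x ≠ y → (t : ℕ∞) < asymDist x y := by
  -- As `t` is finite, the strict bound reads `t + 1 ≤ _`, which passes through the infima.
  simp only [minAsymDist, ← Order.add_one_le_iff_of_not_isMax
    (not_isMax_iff_ne_top.2 (ENat.natCast_ne_top t)), le_iInf_iff]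

/-! ### Moving ones to the right -/

/-- The number of pairs of members `l_{2m} = a`, `l_{2m+1} = a + 1` of the list `l`. -/
def ascents (a : ℕ) : List ℕ → ℕ
  | i :: j :: l => (if i = a ∧ j = a + 1 then 1 else 0) + ascents a l
  | _ => 0

/-- The lists obtained from `l` by swapping `t` of the pairs counted by `ascents`. -/
def swaps (a : ℕ) : ℕ → List ℕ → Finset (List ℕ)
  | 0, l => {l}
  | t + 1, i :: j :: l => (swaps a (t + 1) l).image (fun m => i :: j :: m) ∪
      if i = a ∧ j = a + 1 then (swaps a t l).image (fun m => j :: i :: m) else ∅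
  | _ + 1, _ => ∅

/-- The pairs occupy disjoint slots, so they are swapped independently; the recursion is Pascal's
rule. -/
theorem card_swaps (a t : ℕ) (l : List ℕ) : (swaps a t l).card = (ascents a l).choose t := by
  fun_induction swaps a t l with
  | case1 l => simp
  | case2 t i j l ih1 ih2 =>
    have hinj : ∀ i j : ℕ, Function.Injective fun m : List ℕ => i :: j :: m :=
      fun i j m m' h => by simpa using h
    rw [Finset.card_union_of_disjoint]
    · rw [Finset.card_image_of_injective _ (hinj i j), ih1, ascents]
      split_ifs with h
      · rw [Finset.card_image_of_injective _ (hinj j i), ih2, Nat.add_comm 1,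
          Nat.choose_succ_succ, add_comm]
      · simp
    · split_ifs with h
      · rw [Finset.disjoint_left]
        intro x hx hx'
        obtain ⟨m, -, rfl⟩ := Finset.mem_image.1 hx
        obtain ⟨m', -, hm⟩ := Finset.mem_image.1 hx'
        simp only [List.cons.injEq] at hm
        omega
      · simp
  | case3 l t h =>
    rcases l with _ | ⟨i, _ | ⟨j, l⟩⟩
    · simp [ascents]
    · simp [ascents]
    · exact (h i j l rfl).elim

/-- This keeps swapped words in the same code space and preserves the weight. -/
theorem perm_of_mem_swaps (a t : ℕ) (l : List ℕ) : ∀ m ∈ swaps a t l, m.Perm l := by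
  fun_induction swaps a t l with
  | case1 l => simp
  | case2 t i j l ih1 ih2 =>
    intro m hm
    rcases Finset.mem_union.1 hm with hm | hm
    · obtain ⟨m, h, rfl⟩ := Finset.mem_image.1 hm
      exact ((ih1 m h).cons j).cons i
    · split_ifs at hm
      · obtain ⟨m, h, rfl⟩ := Finset.mem_image.1 hm
        exact (List.Perm.swap i j m).trans (((ih2 m h).cons j).cons i)
      · simp at hm
  | case3 l t h => simp

theorem partialSums_of_mem_swaps (a t : ℕ) (l : List ℕ) :
    ∀ m ∈ swaps a t l, ∀ c, List.Forall₂ (· ≤ ·) (partialSums c l) (partialSums c m) ∧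
      (partialSums c m).sum = (partialSums c l).sum + t := by
  fun_induction swaps a t l with
  | case1 l => simp [List.forall₂_same]
  | case2 t i j l ih1 ih2 =>
    intro m hm c
    rcases Finset.mem_union.1 hm with hm | hm
    · obtain ⟨m, h, rfl⟩ := Finset.mem_image.1 hm
      obtain ⟨h1, h2⟩ := ih1 m h (c + i + j)
      refine ⟨.cons le_rfl (.cons le_rfl h1), ?_⟩
      simp only [partialSums, List.sum_cons, h2]
      omega
    · split_ifs at hm with hij
      · obtain ⟨m, h, rfl⟩ := Finset.mem_image.1 hm
        obtain ⟨h1, h2⟩ := ih2 m h (c + i + j)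
        have hc : c + j + i = c + i + j := by omega
        constructor
        · refine .cons (by omega) (.cons (by omega) ?_)
          rwa [hc]
        · simp only [partialSums, List.sum_cons, hc, h2]
          omega
      · simp at hm
  | case3 l t h => simp

theorem excess_add_sum {u v : List ℕ} (h : List.Forall₂ (· ≤ ·) u v) :
    excess v u + u.sum = v.sum := by
  induction h with
  | nil => rfl
  | @cons i j u v hij h ih =>
    simp only [excess, List.length_cons, Finset.sum_range_succ', List.getD_cons_succ,
      List.getD_cons_zero, List.sum_cons] at ih ⊢
    omega

theorem getD_le_getD {u v : List ℕ} (h : List.Forall₂ (· ≤ ·) u v) (i : ℕ) :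
    u.getD i 0 ≤ v.getD i 0 := by
  induction h generalizing i with
  | nil => simp
  | cons hij h ih => cases i with
    | zero => simpa using hij
    | succ i => simpa using ih i

theorem asymDist_le_of_mem_swaps {a t : ℕ} {l l' m : List ℕ} (hl : ∀ i ∈ l, 0 < i)
    (hl' : ∀ i ∈ l', 0 < i) (hm : m ∈ swaps a t l) (hm' : m ∈ swaps a t l') :
    asymDist (runWord l) (runWord l') ≤ t := by
  have hlen := (perm_of_mem_swaps a t l m hm).length_eq
  have hlen' := (perm_of_mem_swaps a t l' m hm').length_eq
  obtain ⟨h1, h2⟩ := partialSums_of_mem_swaps a t l m hm 0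
  obtain ⟨h1', h2'⟩ := partialSums_of_mem_swaps a t l' m hm' 0
  rw [asymDist_runWord l l' hl hl' (by omega), Nat.cast_le]
  -- A common upper bound `w` dominates `u`, so the excess of `u` over `v` is at most that of `w`
  -- over `v`, which is `t`.
  have key : ∀ u v w : List ℕ, u.length = w.length → List.Forall₂ (· ≤ ·) u w →
      List.Forall₂ (· ≤ ·) v w → w.sum = v.sum + t → excess u v ≤ t := by
    intro u v w huw hu hv hs
    have h := excess_add_sum hv
    have : excess u v ≤ excess w v := by
      rw [excess, excess, huw]
      exact Finset.sum_le_sum fun i _ => Nat.sub_le_sub_right (getD_le_getD hu i) _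
    omega
  exact max_le (key _ _ _ (by simp [hlen]) h1 h1' h2') (key _ _ _ (by simp [hlen']) h1' h1 h2)

/-! ### Codes as sets of lists of block lengths -/

theorem exists_optimalCode (d : ℕ) (k : ℕ∞) (n t : ℕ) :
    ∃ D ⊆ partLists (blockLengths d k) n,
      (∀ l ∈ D, ∀ m ∈ D, l ≠ m → (t : ℕ∞) < asymDist (runWord l) (runWord m)) ∧
      D.card = optimalCodeSize d k n t := by
  classical
  obtain ⟨C, hC, hd, hcard⟩ := (isGreatest_optimalCodeSize d k n t).1
  rw [lt_minAsymDist_iff] at hd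
  have hinj : Set.InjOn runWord (partLists (blockLengths d k) n : Set (List ℕ)) :=
    runWord_injOn.mono fun l hl => (mem_partLists.1 hl).2.1
  refine ⟨(partLists (blockLengths d k) n).filter fun l => runWord l ∈ C,
    Finset.filter_subset _ _, ?_, ?_⟩
  · intro l hl m hm hne
    rw [Finset.mem_filter] at hl hm
    exact hd _ hl.2 _ hm.2 fun h => hne (hinj hl.1 hm.1 h)
  · rw [← hcard, ← Finset.card_image_of_injOn
      (hinj.mono (Finset.coe_subset.2 (Finset.filter_subset _ _)))]
    congr 1
    ext x
    simp only [Finset.mem_image, Finset.mem_filter]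
    constructor
    · rintro ⟨l, ⟨-, h⟩, rfl⟩
      exact h
    · intro hx
      obtain ⟨l, hl, rfl⟩ := mem_codeSpace_iff.1 (hC hx)
      exact ⟨l, ⟨hl, hx⟩, rfl⟩

theorem card_le_optimalCodeSize {d : ℕ} {k : ℕ∞} {n t : ℕ} {D : Finset (List ℕ)}
    (hD : D ⊆ partLists (blockLengths d k) n)
    (hd : ∀ l ∈ D, ∀ m ∈ D, l ≠ m → (t : ℕ∞) < asymDist (runWord l) (runWord m)) :
    D.card ≤ optimalCodeSize d k n t := by
  classical
  have hinj : Set.InjOn runWord (D : Set (List ℕ)) :=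
    runWord_injOn.mono fun l hl => (mem_partLists.1 (hD hl)).2.1
  refine (isGreatest_optimalCodeSize d k n t).2 ⟨D.image runWord, ?_, ?_, ?_⟩
  · intro x hx
    obtain ⟨l, hl, rfl⟩ := Finset.mem_image.1 (Finset.mem_coe.1 hx)
    exact mem_codeSpace_iff.2 ⟨l, hD hl, rfl⟩
  · rw [lt_minAsymDist_iff]
    intro x hx y hy hne
    obtain ⟨l, hl, rfl⟩ := Finset.mem_image.1 (Finset.mem_coe.1 hx)
    obtain ⟨m, hm, rfl⟩ := Finset.mem_image.1 (Finset.mem_coe.1 hy)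
    exact hd l hl m hm fun h => hne (by rw [h])
  · rw [Finset.card_image_of_injOn hinj]

/-- The packing bound: the sets of `t`-fold swaps of different codewords are disjoint. -/
theorem optimalCodeSize_mul_choose_le (d : ℕ) (k : ℕ∞) (n t a m : ℕ) :
    optimalCodeSize d k n t * m.choose t ≤
      ((partLists (blockLengths d k) n).filter fun l => ascents a l < m).card * m.choose t +
        (partLists (blockLengths d k) n).card := by
  classical
  obtain ⟨D, hD, hd, hcard⟩ := exists_optimalCode d k n t
  -- Codewords with few ascents are merely counted; only the others enter the packing argument.
  rw [← hcard, ← Finset.card_filter_add_card_filter_not (s := D) fun l => ascents a l < m,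
    add_mul]
  refine Nat.add_le_add (Nat.mul_le_mul_right _
    (Finset.card_le_card (Finset.filter_subset_filter _ hD))) ?_
  calc _ ≤ ∑ l ∈ D.filter (fun l => ¬ ascents a l < m), (swaps a t l).card := by
        rw [← smul_eq_mul]
        refine Finset.card_nsmul_le_sum _ _ _ fun l hl => ?_
        rw [card_swaps]
        exact Nat.choose_le_choose t (not_lt.1 (Finset.mem_filter.1 hl).2)
    _ = ((D.filter fun l => ¬ ascents a l < m).biUnion (swaps a t)).card := by
        refine (Finset.card_biUnion fun l hl l' hl' hne => ?_).symm
        have hl := (Finset.mem_filter.1 hl).1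
        have hl' := (Finset.mem_filter.1 hl').1
        refine Finset.disjoint_left.2 fun w hw hw' => ?_
        exact (hd l hl l' hl' hne).not_ge (asymDist_le_of_mem_swaps
          (mem_partLists.1 (hD hl)).2.1 (mem_partLists.1 (hD hl')).2.1 hw hw')
    _ ≤ _ := by
        refine Finset.card_le_card fun w hw => ?_
        obtain ⟨l, hl, hw⟩ := Finset.mem_biUnion.1 hw
        obtain ⟨h1, h2, h3⟩ := mem_partLists.1 (hD (Finset.mem_filter.1 hl).1)
        have hp := perm_of_mem_swaps a t l w hw
        exact mem_partLists.2 ⟨fun i hi => h1 i (hp.mem_iff.1 hi),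
          fun i hi => h2 i (hp.mem_iff.1 hi), hp.sum_eq.trans h3⟩

/-! ### Codes from locator polynomials -/

open Polynomial in
/-- The polynomial `∏ i < W, (1 - (i + 1) X) ^ x i`. -/
noncomputable def locator (p W : ℕ) (x : ℕ → ℕ) : (ZMod p)[X] :=
  ∏ i ∈ Finset.range W, (1 - C ((i : ZMod p) + 1) * X) ^ x i

open Polynomial in
theorem locator_add (p W : ℕ) (x y : ℕ → ℕ) :
    locator p W (x + y) = locator p W x * locator p W y := by
  simp [locator, pow_add, Finset.prod_mul_distrib]

open Polynomial in
theorem coeff_zero_locator (p W : ℕ) (x : ℕ → ℕ) : (locator p W x).coeff 0 = 1 := by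
  rw [coeff_zero_eq_eval_zero, locator, eval_prod]
  simp

open Polynomial in
theorem natDegree_locator_le (p W : ℕ) (x : ℕ → ℕ) :
    (locator p W x).natDegree ≤ ∑ i ∈ Finset.range W, x i := by
  refine (natDegree_prod_le _ _).trans (Finset.sum_le_sum fun i _ => ?_)
  refine natDegree_pow_le.trans ?_
  have : (1 - C ((i : ZMod p) + 1) * X : (ZMod p)[X]).natDegree ≤ 1 := by compute_degree
  simpa using Nat.mul_le_mul_left (x i) this

-- `W < p` makes the elements `i + 1` with `i < W` nonzero and distinct modulo `p`, so each factor
-- has its own root.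
open Polynomial in
theorem eval_locator_eq_zero_iff (p W : ℕ) [Fact p.Prime] (hW : W < p) (x : ℕ → ℕ) {j : ℕ}
    (hj : j < W) : (locator p W x).eval ((j : ZMod p) + 1)⁻¹ = 0 ↔ x j ≠ 0 := by
  have hne : ∀ i < W, ((i : ZMod p) + 1) ≠ 0 := by
    intro i hi h
    have h' : ((i + 1 : ℕ) : ZMod p) = 0 := by exact_mod_cast h
    rw [ZMod.natCast_eq_zero_iff] at h'
    exact absurd (Nat.le_of_dvd (by omega) h') (by omega)
  rw [locator, eval_prod, Finset.prod_eq_zero_iff]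
  constructor
  · rintro ⟨i, hi, h⟩
    rw [Finset.mem_range] at hi
    simp only [eval_pow, eval_sub, eval_one, eval_mul, eval_C, eval_X, pow_eq_zero_iff',
      sub_eq_zero] at h
    obtain ⟨h, h'⟩ := h
    rw [← div_eq_mul_inv, eq_comm, div_eq_one_iff_eq (hne j hj), add_left_inj,
      ZMod.natCast_eq_natCast_iff, Nat.ModEq, Nat.mod_eq_of_lt (by omega),
      Nat.mod_eq_of_lt (by omega)] at h
    rwa [← h]
  · intro h
    refine ⟨j, Finset.mem_range.2 hj, ?_⟩
    simp [hne j hj, h]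

-- The common part `x ⊓ y` cancels, since its locator has constant term 1 and is coprime to `X`. The
-- remaining locators have degree at most `t` and agree modulo `X ^ (t + 1)`, so they are equal.
open Polynomial in
theorem eq_of_X_pow_dvd_locator_sub {p W t : ℕ} [Fact p.Prime] (hW : W < p) {x y : ℕ → ℕ}
    (hxy : ∑ i ∈ Finset.range W, (x i - y i) ≤ t) (hyx : ∑ i ∈ Finset.range W, (y i - x i) ≤ t)
    (h : X ^ (t + 1) ∣ locator p W x - locator p W y) {i : ℕ} (hi : i < W) : x i = y i := by
  have hx : locator p W x = locator p W (x ⊓ y) * locator p W (x - y) := by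
    rw [← locator_add]
    congr 1
    ext j; simp only [Pi.add_apply, Pi.inf_apply, Pi.sub_apply]; omega
  have hy : locator p W y = locator p W (x ⊓ y) * locator p W (y - x) := by
    rw [← locator_add]
    congr 1
    ext j; simp only [Pi.add_apply, Pi.inf_apply, Pi.sub_apply]; omega
  rw [hx, hy, ← mul_sub] at h
  have hcop : IsCoprime (X ^ (t + 1)) (locator p W (x ⊓ y)) := by
    refine IsCoprime.pow_left ((irreducible_X.coprime_iff_not_dvd).2 fun hd => ?_)
    rw [X_dvd_iff, coeff_zero_locator] at hd
    exact one_ne_zero hd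
  have h0 : locator p W (x - y) = locator p W (y - x) := by
    rw [← sub_eq_zero]
    refine eq_zero_of_dvd_of_natDegree_lt (hcop.dvd_of_dvd_mul_left h) ?_
    rw [natDegree_X_pow, Nat.lt_succ_iff]
    exact (natDegree_sub_le _ _).trans (max_le ((natDegree_locator_le _ _ _).trans hxy)
      ((natDegree_locator_le _ _ _).trans hyx))
  -- Equal polynomials have equal roots, but the truncated differences `x - y` and `y - x` are never
  -- both nonzero at `i`.
  have h1 := eval_locator_eq_zero_iff p W hW (x - y) hi
  have h2 := eval_locator_eq_zero_iff p W hW (y - x) hi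
  rw [h0] at h1
  have := h1.symm.trans h2
  simp only [Pi.sub_apply] at this
  omega

-- Pigeonhole on the coefficients of `X, …, X ^ t`: every fibre is a code with distance larger than
-- `t`.
open Polynomial in
theorem card_partLists_le (d : ℕ) (k : ℕ∞) (n t p : ℕ) (hp : p.Prime) (hn : n < p) :
    (partLists (blockLengths d k) n).card ≤ optimalCodeSize d k n t * p ^ t := by
  classical
  have := Fact.mk hp
  let F : List ℕ → (ZMod p)[X] := fun l => locator p l.length fun i => (partialSums 0 l).getD i 0
  let f : List ℕ → Fin t → ZMod p := fun l j => (F l).coeff (j + 1)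
  have hcard : p ^ t = (Finset.univ : Finset (Fin t → ZMod p)).card := by
    simp [ZMod.card]
  rw [hcard]
  refine Finset.card_le_mul_card_image_of_maps_to (f := f) (fun _ _ => Finset.mem_univ _) _
    fun g _ => card_le_optimalCodeSize (Finset.filter_subset _ _) ?_
  intro l hl m hm hne
  obtain ⟨hl, hlg⟩ := Finset.mem_filter.1 hl
  obtain ⟨hm, hmg⟩ := Finset.mem_filter.1 hm
  obtain ⟨-, hl0, hls⟩ := mem_partLists.1 hl
  obtain ⟨-, hm0, hms⟩ := mem_partLists.1 hm
  by_cases hlen : l.length = m.length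
  swap
  · rw [asymDist_runWord_of_ne _ _ hlen]
    exact ENat.natCast_lt_top t
  by_contra hlt
  rw [asymDist_runWord l m hl0 hm0 hlen, not_lt, Nat.cast_le, max_le_iff] at hlt
  have hW : l.length < p := by
    refine lt_of_le_of_lt ?_ hn
    rw [← hls]
    exact List.length_le_sum_of_one_le l hl0
  apply hne
  apply partialSums_injective 0
  refine List.ext_getElem (by simp [hlen]) fun i h1 h2 => ?_
  rw [← List.getD_eq_getElem _ 0 h1, ← List.getD_eq_getElem _ 0 h2]
  rw [length_partialSums] at h1
  refine eq_of_X_pow_dvd_locator_sub (t := t) hW (x := fun i => (partialSums 0 l).getD i 0)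
    (y := fun i => (partialSums 0 m).getD i 0) ?_ ?_ ?_ h1
  · simpa [excess] using hlt.1
  · simpa [excess, hlen] using hlt.2
  · have hFm : locator p l.length (fun i => (partialSums 0 m).getD i 0) = F m := by
      simp only [F, hlen]
    rw [hFm, X_pow_dvd_iff]
    intro j hj
    rw [coeff_sub, sub_eq_zero]
    rcases j with _ | j
    · rw [coeff_zero_locator, coeff_zero_locator]
    · exact congrFun (hlg.trans hmg.symm) ⟨j, by omega⟩

/-! ### Counting lists of block lengths -/

theorem partLists_zero (A : Set ℕ) : partLists A 0 = {[]} := by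
  ext l
  rw [mem_partLists, Finset.mem_singleton]
  constructor
  · rintro ⟨-, h0, hs⟩
    rw [List.sum_eq_zero_iff] at hs
    exact List.eq_nil_iff_forall_not_mem.2 fun i hi => (h0 i hi).ne' (hs i hi)
  · rintro rfl
    simp

open Classical in
theorem sum_partLists (A : Set ℕ) {n : ℕ} (hn : 0 < n) (f : List ℕ → ℝ) :
    ∑ l ∈ partLists A n, f l =
      ∑ i ∈ (Finset.Icc 1 n).filter (· ∈ A), ∑ l ∈ partLists A (n - i), f (i :: l) := by
  have h : partLists A n = ((Finset.Icc 1 n).filter (· ∈ A)).biUnion fun i =>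
      (partLists A (n - i)).image (List.cons i) := by
    ext l
    simp only [Finset.mem_biUnion, Finset.mem_filter, Finset.mem_Icc, Finset.mem_image,
      mem_partLists]
    constructor
    · rintro ⟨hA, h0, hs⟩
      cases l with
      | nil => simp at hs; omega
      | cons i l =>
        rw [List.sum_cons] at hs
        simp only [List.mem_cons, forall_eq_or_imp] at hA h0
        exact ⟨i, ⟨⟨h0.1, by omega⟩, hA.1⟩, l, ⟨hA.2, h0.2, by omega⟩, rfl⟩
    · rintro ⟨i, ⟨⟨hi, hin⟩, hiA⟩, l, ⟨hA, h0, hs⟩, rfl⟩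
      simp only [List.mem_cons, forall_eq_or_imp, List.sum_cons]
      exact ⟨⟨hiA, hA⟩, ⟨hi, h0⟩, by omega⟩
  rw [h, Finset.sum_biUnion]
  · exact Finset.sum_congr rfl fun i _ => Finset.sum_image fun l _ m _ h => by simpa using h
  · intro i _ j _ hij
    refine Finset.disjoint_left.2 fun l hl hl' => ?_
    obtain ⟨m, -, rfl⟩ := Finset.mem_image.1 hl
    obtain ⟨m', -, h⟩ := Finset.mem_image.1 hl'
    simp only [List.cons.injEq] at h
    exact hij h.1.symm

open Classical in
theorem card_partLists_eq_sum (A : Set ℕ) {n : ℕ} (hn : 0 < n) :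
    ((partLists A n).card : ℝ) =
      ∑ i ∈ (Finset.Icc 1 n).filter (· ∈ A), ((partLists A (n - i)).card : ℝ) := by
  simpa using sum_partLists A hn fun _ => 1

theorem summable_pow_subtype (A : Set ℕ) {x : ℝ} (h0 : 0 ≤ x) (h1 : x < 1) :
    Summable fun i : A => x ^ (i : ℕ) :=
  (summable_geometric_of_lt_one h0 h1).subtype A

theorem sum_pow_le_tsum {A : Set ℕ} {x : ℝ} (h0 : 0 ≤ x) (h1 : x < 1) {I : Finset ℕ}
    (hI : ∀ i ∈ I, i ∈ A) : ∑ i ∈ I, x ^ i ≤ ∑' i : A, x ^ (i : ℕ) := by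
  rw [tsum_subtype A fun i => x ^ i, ← Finset.sum_congr rfl fun i hi =>
    Set.indicator_of_mem (hI i hi) fun i => x ^ i]
  exact Summable.sum_le_tsum _ (fun i _ => Set.indicator_nonneg (fun i _ => pow_nonneg h0 i) i)
    ((summable_geometric_of_lt_one h0 h1).indicator A)

theorem continuousOn_tsum_pow (A : Set ℕ) {r : ℝ} (h0 : 0 ≤ r) (h1 : r < 1) :
    ContinuousOn (fun x : ℝ => ∑' i : A, x ^ (i : ℕ)) (Set.Icc 0 r) := by
  refine continuousOn_tsum (fun i => (continuous_pow _).continuousOn)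
    (summable_pow_subtype A h0 h1) fun i x hx => ?_
  rw [Real.norm_of_nonneg (pow_nonneg hx.1 _)]
  exact pow_le_pow_left₀ hx.1 hx.2 _

/-- Splitting off the first block bounds the normalised count by earlier ones with weights `x ^ i`
of total at most 1. -/
theorem card_partLists_mul_pow_le {A : Set ℕ} {x : ℝ} (h0 : 0 < x) (h1 : x < 1)
    (hA : ∑' i : A, x ^ (i : ℕ) ≤ 1) (n : ℕ) : ((partLists A n).card : ℝ) * x ^ n ≤ 1 := by
  classical
  induction n using Nat.strong_induction_on with
  | _ n ih =>
    rcases Nat.eq_zero_or_pos n with rfl | hn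
    · simp [partLists_zero]
    rw [card_partLists_eq_sum A hn, Finset.sum_mul]
    refine le_trans (Finset.sum_le_sum fun i hi => ?_)
      ((sum_pow_le_tsum h0.le h1 (I := (Finset.Icc 1 n).filter (· ∈ A))
        fun i hi => (Finset.mem_filter.1 hi).2).trans hA)
    have hi := Finset.mem_Icc.1 (Finset.mem_filter.1 hi).1
    rw [← Nat.sub_add_cancel hi.2, pow_add, Nat.add_sub_cancel, ← mul_assoc]
    exact mul_le_of_le_one_left (pow_nonneg h0.le _) (ih _ (by omega))

/-- Blocks are read two at a time. The left side of `hA` is the generating function of a weighted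
pair of blocks, so sequences of pairs are controlled by a geometric series of ratio `θ`. -/
theorem sum_ascents_mul_pow_le {A : Set ℕ} {a : ℕ} (ha : a ∈ A) (ha' : a + 1 ∈ A)
    {x : ℝ} (h0 : 0 < x) (h1 : x < 1) {θ : ℝ} (hθ : θ < 1)
    (hA : (∑' i : A, x ^ (i : ℕ)) ^ 2 - 1 / 2 * x ^ (2 * a + 1) ≤ θ) (n : ℕ) :
    (∑ l ∈ partLists A n, (1 / 2 : ℝ) ^ ascents a l) * x ^ n ≤ 1 / (1 - θ) := by
  classical
  set S : ℕ → ℝ := fun n => ∑ l ∈ partLists A n, (1 / 2 : ℝ) ^ ascents a l with hS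
  let w : ℕ → ℕ → ℝ := fun i j => 1 - if i = a ∧ j = a + 1 then 1 / 2 else 0
  have hw : ∀ i j, 0 ≤ w i j := by
    intro i j
    simp only [w]
    split_ifs <;> norm_num
  have hwp : ∀ i j l, (1 / 2 : ℝ) ^ ascents a (i :: j :: l) = w i j * (1 / 2) ^ ascents a l := by
    intro i j l
    simp only [ascents, pow_add, w]
    split_ifs <;> norm_num
  let I : ℕ → Finset ℕ := fun n => (Finset.Icc 1 n).filter (· ∈ A)
  -- The range is large enough to contain `a` and `a + 1` as well as all lengths up to `n`.
  let J : Finset ℕ := (Finset.range (n + a + 2)).filter (· ∈ A)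
  have hJ : ∑ i ∈ J, ∑ j ∈ J, w i j * x ^ (i + j) ≤ θ := by
    refine le_trans (le_of_eq ?_) (le_trans (sub_le_sub_right (pow_le_pow_left₀
      (Finset.sum_nonneg fun i _ => pow_nonneg h0.le i) (sum_pow_le_tsum h0.le h1 (I := J)
        fun i hi => (Finset.mem_filter.1 hi).2) 2) _) hA)
    simp only [w, sub_mul, one_mul, Finset.sum_sub_distrib]
    congr 1
    · rw [sq, Finset.sum_mul_sum]
      simp only [pow_add]
    · rw [Finset.sum_eq_single a, Finset.sum_eq_single (a + 1)]
      · simp; ring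
      · intro j _ hj; simp [hj]
      · intro h; exact (h (by simp [J, ha'])).elim
      · intro i _ hi; simp [hi]
      · intro h; exact (h (by simp [J, ha]; omega)).elim
  have hpos : 0 ≤ θ := le_trans (Finset.sum_nonneg fun i _ => Finset.sum_nonneg fun j _ =>
    mul_nonneg (hw i j) (pow_nonneg h0.le _)) hJ
  -- The bound is the fixed point of `B = 1 + θ B`, which closes the induction.
  have hB : 1 / (1 - θ) = 1 + θ * (1 / (1 - θ)) := by
    field_simp [(sub_pos.2 hθ).ne']
    ring
  have hB0 : 0 ≤ 1 / (1 - θ) := by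
    have := sub_pos.2 hθ
    positivity
  suffices H : ∀ m ≤ n, S m * x ^ m ≤ 1 / (1 - θ) from H n le_rfl
  intro m
  induction m using Nat.strong_induction_on with
  | _ m ih =>
    intro hmn
    rcases Nat.eq_zero_or_pos m with rfl | hm
    · simp only [hS, partLists_zero, Finset.sum_singleton, ascents, pow_zero, mul_one]
      rw [hB]
      have := mul_nonneg hpos hB0
      linarith
    -- The summand 1 accounts for the list `[m]`, the only one without a second block.
    have hrec : S m ≤ 1 + ∑ i ∈ I m, ∑ j ∈ I (m - i), w i j * S (m - i - j) := by
      have h2 : S m = ∑ i ∈ I m, ∑ l ∈ partLists A (m - i), (1 / 2 : ℝ) ^ ascents a (i :: l) :=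
        sum_partLists A hm _
      have h3 : ∑ i ∈ I m, (if m = i then (1 : ℝ) else 0) ≤ 1 := by
        rw [Finset.sum_ite_eq]
        split_ifs <;> norm_num
      refine le_trans ?_ (add_le_add_left h3 _)
      rw [h2, ← Finset.sum_add_distrib]
      refine Finset.sum_le_sum fun i hi => ?_
      have hi := Finset.mem_Icc.1 (Finset.mem_filter.1 hi).1
      rcases Nat.eq_zero_or_pos (m - i) with h | h
      · rw [if_pos (by omega), h]
        simp [partLists_zero, ascents, I]
      · rw [if_neg (by omega), zero_add, sum_partLists A h]
        refine le_of_eq (Finset.sum_congr rfl fun j _ => ?_)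
        simp only [hwp, hS, Finset.mul_sum]
    have hterm : ∀ i ∈ I m, ∀ j ∈ I (m - i), w i j * S (m - i - j) * x ^ m ≤
        w i j * x ^ (i + j) * (1 / (1 - θ)) := by
      intro i hi j hj
      have hi := Finset.mem_Icc.1 (Finset.mem_filter.1 hi).1
      have hj := Finset.mem_Icc.1 (Finset.mem_filter.1 hj).1
      have hm : m = (i + j) + (m - i - j) := by omega
      have := ih (m - i - j) (by omega) (by omega)
      calc w i j * S (m - i - j) * x ^ m
          = w i j * x ^ (i + j) * (S (m - i - j) * x ^ (m - i - j)) := by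
            conv_lhs => rw [hm, pow_add, ← hm]
            ring
        _ ≤ _ := mul_le_mul_of_nonneg_left this (mul_nonneg (hw i j) (pow_nonneg h0.le _))
    have hIJ : ∀ m' ≤ m, I m' ⊆ J := by
      intro m' hm' i hi
      simp only [I, J, Finset.mem_filter, Finset.mem_Icc, Finset.mem_range] at hi ⊢
      exact ⟨by omega, hi.2⟩
    have hnn : ∀ i j, 0 ≤ w i j * x ^ (i + j) := fun i j =>
      mul_nonneg (hw i j) (pow_nonneg h0.le _)
    calc S m * x ^ m
        ≤ (1 + ∑ i ∈ I m, ∑ j ∈ I (m - i), w i j * S (m - i - j)) * x ^ m :=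
          mul_le_mul_of_nonneg_right hrec (pow_nonneg h0.le _)
      _ = x ^ m + ∑ i ∈ I m, ∑ j ∈ I (m - i), w i j * S (m - i - j) * x ^ m := by
          simp only [add_mul, one_mul, Finset.sum_mul]
      _ ≤ 1 + ∑ i ∈ I m, ∑ j ∈ I (m - i), w i j * x ^ (i + j) * (1 / (1 - θ)) :=
          add_le_add (pow_le_one₀ h0.le h1.le)
            (Finset.sum_le_sum fun i hi => Finset.sum_le_sum fun j hj => hterm i hi j hj)
      _ = 1 + (∑ i ∈ I m, ∑ j ∈ I (m - i), w i j * x ^ (i + j)) * (1 / (1 - θ)) := by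
          simp only [Finset.sum_mul]
      _ ≤ 1 + (∑ i ∈ J, ∑ j ∈ J, w i j * x ^ (i + j)) * (1 / (1 - θ)) := by
          gcongr
          exact (Finset.sum_le_sum fun i _ => Finset.sum_le_sum_of_subset_of_nonneg
            (hIJ _ (by omega)) fun j _ _ => hnn i j).trans
            (Finset.sum_le_sum_of_subset_of_nonneg (hIJ _ le_rfl) fun i _ _ =>
              Finset.sum_nonneg fun j _ => hnn i j)
      _ ≤ 1 + θ * (1 / (1 - θ)) := by gcongr
      _ = 1 / (1 - θ) := hB.symm

/-- Markov's inequality: each counted list has weight at least `2 ^ (-m)`. -/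
theorem card_filter_ascents_lt_le (A : Set ℕ) (a n m : ℕ) :
    (((partLists A n).filter fun l => ascents a l < m).card : ℝ) ≤
      2 ^ m * ∑ l ∈ partLists A n, (1 / 2 : ℝ) ^ ascents a l := by
  rw [Finset.mul_sum, Finset.card_filter, Nat.cast_sum]
  refine Finset.sum_le_sum fun l _ => ?_
  split_ifs with h
  · rw [one_div, inv_pow, ← div_eq_mul_inv, Nat.cast_one, one_le_div (by positivity)]
    exact pow_le_pow_right₀ one_le_two h.le
  · rw [Nat.cast_zero]
    positivity

theorem card_partLists_pos {A : Set ℕ} {a : ℕ} (h0 : 0 < a) (ha : a ∈ A) (ha' : a + 1 ∈ A)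
    {n : ℕ} (hn : a * a ≤ n) : 0 < (partLists A n).card := by
  have h1 : a ≤ n / a := (Nat.le_div_iff_mul_le h0).2 hn
  have h2 := Nat.mod_lt n h0
  have h3 := Nat.div_add_mod n a
  -- Start from `n / a` blocks of length `a` and lengthen `n % a` of them by one; `a * a ≤ n`
  -- ensures there are enough.
  refine Finset.card_pos.2 ⟨List.replicate (n / a - n % a) a ++ List.replicate (n % a) (a + 1),
    mem_partLists.2 ⟨?_, ?_, ?_⟩⟩
  · intro i hi
    rcases List.mem_append.1 hi with hi | hi <;> rw [List.eq_of_mem_replicate hi] <;> assumption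
  · intro i hi
    rcases List.mem_append.1 hi with hi | hi <;> rw [List.eq_of_mem_replicate hi] <;> omega
  · obtain ⟨q, hq⟩ := Nat.exists_eq_add_of_le (h2.le.trans h1)
    rw [hq] at h3
    rw [List.sum_append, List.sum_replicate, List.sum_replicate, hq, Nat.add_sub_cancel_left]
    simp only [smul_eq_mul]
    nlinarith

/-- A sequence that satisfies a linear recursive inequality with a root `ρ` of the
characteristic equation grows at least like `ρ ^ (-n)`. -/
theorem exists_le_mul_pow_of_recursion {s w : ℕ → ℝ} {ρ : ℝ} (hρ : 0 < ρ) {K N : ℕ} (hK : 0 < K)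
    (hw : ∀ i, 0 ≤ w i) (hs : ∀ n, N ≤ n → 0 < s n)
    (hrec : ∀ n, N + K ≤ n → ∑ i ∈ Finset.Icc 1 K, w i * s (n - i) ≤ s n)
    (hsum : ∑ i ∈ Finset.Icc 1 K, w i * ρ ^ i = 1) :
    ∃ c > 0, ∀ n, N ≤ n → c ≤ s n * ρ ^ n := by
  -- Each later value of `s n * ρ ^ n` is at least a weighted average of the `K` preceding ones, so
  -- the minimum over an initial window persists.
  obtain ⟨n₀, hn₀, hmin⟩ := Finset.exists_min_image (Finset.Ico N (N + K))
    (fun n => s n * ρ ^ n) ⟨N, by simp [hK]⟩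
  refine ⟨s n₀ * ρ ^ n₀, mul_pos (hs _ (Finset.mem_Ico.1 hn₀).1) (pow_pos hρ _), fun n => ?_⟩
  induction n using Nat.strong_induction_on with
  | _ n ih =>
    intro hn
    rcases lt_or_ge n (N + K) with h | h
    · exact hmin n (Finset.mem_Ico.2 ⟨hn, h⟩)
    calc s n₀ * ρ ^ n₀ = ∑ i ∈ Finset.Icc 1 K, w i * ρ ^ i * (s n₀ * ρ ^ n₀) := by
          rw [← Finset.sum_mul, hsum, one_mul]
      _ ≤ ∑ i ∈ Finset.Icc 1 K, w i * s (n - i) * ρ ^ n := by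
          refine Finset.sum_le_sum fun i hi => ?_
          have hi := Finset.mem_Icc.1 hi
          have hin : n = i + (n - i) := by omega
          calc _ ≤ w i * ρ ^ i * (s (n - i) * ρ ^ (n - i)) :=
                mul_le_mul_of_nonneg_left (ih _ (by omega) (by omega))
                  (mul_nonneg (hw i) (pow_nonneg hρ.le _))
            _ = _ := by
                conv_rhs => rw [hin, pow_add, ← hin]
                ring
      _ ≤ s n * ρ ^ n := by
          rw [← Finset.sum_mul]
          exact mul_le_mul_of_nonneg_right (hrec n h) (pow_nonneg hρ.le _)

/-! ### The characteristic root -/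

theorem mem_blockLengths_of_lt {d : ℕ} {k : ℕ∞} (h : (d : ℕ∞) < k) :
    d + 1 ∈ blockLengths d k ∧ d + 1 + 1 ∈ blockLengths d k := by
  refine ⟨⟨le_rfl, ?_⟩, ⟨by omega, ?_⟩⟩
  · push_cast
    gcongr
  · push_cast
    gcongr
    exact Order.add_one_le_of_lt h

theorem lt_one_of_hasSum_pow {A : Set ℕ} {a : ℕ} (ha : a ∈ A) (ha' : a + 1 ∈ A) {x : ℝ}
    (h0 : 0 < x) (h : HasSum (fun i : A => x ^ (i : ℕ)) 1) : x < 1 := by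
  by_contra! h1
  have h2 := sum_le_hasSum (f := fun i : A => x ^ (i : ℕ)) {⟨a, ha⟩, ⟨a + 1, ha'⟩}
    (fun i _ => pow_nonneg h0.le (i : ℕ)) h
  rw [Finset.sum_pair (by simp)] at h2
  have h3 := one_le_pow₀ h1 (n := a)
  have h4 := one_le_pow₀ h1 (n := a + 1)
  simp only at h2
  linarith

theorem eq_of_hasSum_pow {A : Set ℕ} {a : ℕ} (ha : a ∈ A) (h0 : 0 < a) {x y : ℝ} (hx : 0 < x)
    (hy : 0 < y) (hxs : HasSum (fun i : A => x ^ (i : ℕ)) 1)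
    (hys : HasSum (fun i : A => y ^ (i : ℕ)) 1) : x = y := by
  have key : ∀ x y : ℝ, 0 < x → x < y → HasSum (fun i : A => x ^ (i : ℕ)) 1 →
      ¬ HasSum (fun i : A => y ^ (i : ℕ)) 1 := fun x y hx hxy hxs hys =>
    (hasSum_lt (f := fun i : A => x ^ (i : ℕ)) (g := fun i : A => y ^ (i : ℕ)) (i := ⟨a, ha⟩)
      (fun i => pow_le_pow_left₀ hx.le hxy.le (i : ℕ))
      (pow_lt_pow_left₀ hxy hx.le h0.ne') hxs hys).false
  rcases lt_trichotomy x y with h | h | h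
  · exact (key x y hx h hxs hys).elim
  · exact h
  · exact (key y x hy h hys hxs).elim

theorem exists_hasSum_pow {A : Set ℕ} {a : ℕ} (h0 : 0 ∉ A) (ha : a ∈ A) (ha' : a + 1 ∈ A) :
    ∃ x : ℝ, 0 < x ∧ HasSum (fun i : A => x ^ (i : ℕ)) 1 := by
  -- Two terms tend to 2 as `r` tends to 1, so the intermediate value theorem applies on an interval
  -- where the series converges.
  obtain ⟨r, hr, hr0, hr1⟩ : ∃ r : ℝ, 1 < r ^ a + r ^ (a + 1) ∧ 0 < r ∧ r < 1 := by
    have hc : Continuous fun r : ℝ => r ^ a + r ^ (a + 1) := by fun_prop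
    have h1 : ∀ᶠ r in nhdsWithin (1 : ℝ) (Set.Iio 1), 1 < r ^ a + r ^ (a + 1) :=
      (hc.continuousAt.eventually (lt_mem_nhds (by norm_num))).filter_mono nhdsWithin_le_nhds
    have h2 : ∀ᶠ r in nhdsWithin (1 : ℝ) (Set.Iio 1), 0 < r :=
      (lt_mem_nhds zero_lt_one).filter_mono nhdsWithin_le_nhds
    exact (h1.and (h2.and self_mem_nhdsWithin)).exists
  have hg0 : ∑' i : A, (0 : ℝ) ^ (i : ℕ) = 0 := by
    refine (tsum_congr fun i : A => zero_pow fun h => h0 (h ▸ i.2)).trans tsum_zero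
  have hgr : 1 ≤ ∑' i : A, r ^ (i : ℕ) := by
    refine hr.le.trans (le_trans (le_of_eq ?_)
      (sum_pow_le_tsum hr0.le hr1 (I := {a, a + 1}) ?_))
    · rw [Finset.sum_pair (by simp)]
    · intro i hi
      simp only [Finset.mem_insert, Finset.mem_singleton] at hi
      rcases hi with rfl | rfl <;> assumption
  obtain ⟨x, hx, hx1⟩ := intermediate_value_Icc hr0.le (continuousOn_tsum_pow A hr0.le hr1)
    (show (1 : ℝ) ∈ Set.Icc _ _ from ⟨by simp only [hg0]; norm_num, hgr⟩)
  have hx1 : ∑' i : A, x ^ (i : ℕ) = 1 := hx1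
  refine ⟨x, hx.1.lt_of_ne ?_, ?_⟩
  · rintro rfl
    rw [hg0] at hx1
    exact zero_ne_one hx1
  · refine hx1 ▸ (summable_pow_subtype A hx.1 (hx.2.trans_lt hr1)).hasSum

/-- At `ρ` the expression equals `1 - ρ ^ b / 2`; continuity leaves room to the right of `ρ`, which
is the source of the exponential gain. -/
theorem exists_gt_sq_tsum_lt_one {A : Set ℕ} (b : ℕ) {ρ : ℝ} (h0 : 0 < ρ) (h1 : ρ < 1)
    (h : ∑' i : A, ρ ^ (i : ℕ) = 1) :
    ∃ x, ρ < x ∧ x < 1 ∧ (∑' i : A, x ^ (i : ℕ)) ^ 2 - 1 / 2 * x ^ b < 1 := by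
  obtain ⟨r, hr, hr1⟩ := exists_between h1
  have hc : ContinuousAt (fun x : ℝ => (∑' i : A, x ^ (i : ℕ)) ^ 2 - 1 / 2 * x ^ b) ρ :=
    (((continuousOn_tsum_pow A (h0.trans hr).le hr1).continuousAt
      (Icc_mem_nhds h0 hr)).pow 2).sub (by fun_prop)
  have h2 : ∀ᶠ x in nhdsWithin ρ (Set.Ioi ρ),
      (∑' i : A, x ^ (i : ℕ)) ^ 2 - 1 / 2 * x ^ b < 1 := by
    refine (hc.eventually (gt_mem_nhds ?_)).filter_mono nhdsWithin_le_nhds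
    simp only [h]
    have := pow_pos h0 b
    linarith
  have h3 : ∀ᶠ x in nhdsWithin ρ (Set.Ioi ρ), x < 1 :=
    (gt_mem_nhds h1).filter_mono nhdsWithin_le_nhds
  obtain ⟨x, hx, hx1, hx2⟩ := ((eventually_mem_nhdsWithin (a := ρ) (s := Set.Ioi ρ)).and (h3.and h2)).exists
  exact ⟨x, hx, hx1, hx2⟩

/-! ### Growth of the code space -/

theorem exists_le_card_partLists_mul_pow {d : ℕ} {k : ℕ∞} (hdk : (d : ℕ∞) < k) {ρ : ℝ}
    (h0 : 0 < ρ) (hs : HasSum (fun i : blockLengths d k => ρ ^ (i : ℕ)) 1) :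
    ∃ c > 0, ∃ N, ∀ n, N ≤ n → c ≤ ((partLists (blockLengths d k) n).card : ℝ) * ρ ^ n := by
  classical
  obtain ⟨ha, ha'⟩ := mem_blockLengths_of_lt hdk
  have h1 := lt_one_of_hasSum_pow ha ha' h0 hs
  have hpos : ∀ n, (d + 1) * (d + 1) ≤ n →
      (0 : ℝ) < ((partLists (blockLengths d k) n).card : ℝ) :=
    fun n hn => Nat.cast_pos.2 (card_partLists_pos d.succ_pos ha ha' hn)
  induction k using ENat.recTopCoe with
  | top =>
    have hmem : ∀ i, i ∈ blockLengths d ⊤ ↔ d + 1 ≤ i := fun i => by simp [blockLengths]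
    -- Summing the geometric series replaces the infinite recursion by a finite one.
    have hρ : ρ + ρ ^ (d + 1) = 1 := by
      have hg := (hasSum_geometric_of_lt_one h0.le h1).mul_left (ρ ^ (d + 1))
      have hinj : Function.Injective fun i : ℕ =>
          (⟨i + (d + 1), (hmem _).2 (by omega)⟩ : blockLengths d ⊤) :=
        fun i j h => by simpa using h
      have h2 : HasSum (fun i : ℕ => ρ ^ (d + 1) * ρ ^ i) 1 := by
        have := (hinj.hasSum_iff (f := fun i : blockLengths d ⊤ => ρ ^ (i : ℕ)) (a := 1) ?_).2 hs
        · simpa only [Function.comp_def, pow_add, mul_comm] using this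
        · rintro ⟨i, hi⟩ h
          refine (h ⟨i - (d + 1), Subtype.ext ?_⟩).elim
          exact Nat.sub_add_cancel ((hmem i).1 hi)
      have h3 := hg.unique h2
      have h4 : 1 - ρ ≠ 0 := (sub_pos.2 h1).ne'
      rw [← div_eq_mul_inv, div_eq_one_iff_eq h4] at h3
      linarith
    -- The first block either has length `d + 1` and is removed, or is longer and is shortened by
    -- one.
    have key : ∀ n, 2 ≤ n → ((partLists (blockLengths d ⊤) n).card : ℝ) ≥
        (partLists (blockLengths d ⊤) (n - 1)).card +
          if d + 1 ≤ n then ((partLists (blockLengths d ⊤) (n - (d + 1))).card : ℝ) else 0 := by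
      intro n hn
      obtain ⟨n, rfl⟩ := Nat.exists_eq_add_of_le' (Nat.one_le_of_lt hn)
      rw [card_partLists_eq_sum _ (n := n + 1) (by omega), Nat.add_sub_cancel,
        card_partLists_eq_sum _ (n := n) (by omega), ← Finset.sum_filter_add_sum_filter_not
          (Finset.filter _ (Finset.Icc 1 (n + 1))) fun i => i = d + 1, add_comm]
      refine add_le_add ?_ ?_
      · calc _ = ∑ i ∈ ((Finset.Icc 1 n).filter (· ∈ blockLengths d ⊤)).map (addRightEmbedding 1),
              ((partLists (blockLengths d ⊤) (n + 1 - i)).card : ℝ) := by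
              simp [Finset.sum_map]
          _ ≤ _ := by
              refine Finset.sum_le_sum_of_subset_of_nonneg ?_ fun _ _ _ => Nat.cast_nonneg _
              intro i hi
              obtain ⟨j, hj, rfl⟩ := Finset.mem_map.1 hi
              simp only [Finset.mem_filter, Finset.mem_Icc, hmem, addRightEmbedding_apply] at hj ⊢
              omega
      · split_ifs with h
        · rw [← Finset.sum_singleton (fun i => ((partLists (blockLengths d ⊤) (n + 1 - i)).card : ℝ))
            (d + 1)]
          refine Finset.sum_le_sum_of_subset_of_nonneg ?_ fun _ _ _ => Nat.cast_nonneg _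
          intro i hi
          rw [Finset.mem_singleton.1 hi]
          simp [hmem, h]
        · exact Finset.sum_nonneg fun _ _ => Nat.cast_nonneg _
    -- For `d = 0` the two indicators coincide, and the weight at `i = 1` is 2.
    refine (exists_le_mul_pow_of_recursion
      (s := fun n => ((partLists (blockLengths d ⊤) n).card : ℝ))
      (w := fun i => (if i = 1 then 1 else 0) + if i = d + 1 then 1 else 0) h0 d.succ_pos
      (N := (d + 1) * (d + 1) + 1) (fun i => by positivity) (fun n hn => hpos n (by omega)) ?_ ?_).imp
      fun c h => ⟨h.1, _, h.2⟩
    · intro n hn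
      have := key n (by omega)
      rw [if_pos (by omega)] at this
      simpa [add_mul, Finset.sum_add_distrib] using this
    · simpa [add_mul, Finset.sum_add_distrib] using hρ
  | coe k =>
    have hmem : ∀ i, i ∈ blockLengths d k ↔ i ∈ Finset.Icc (d + 1) (k + 1) := by
      intro i
      rw [Finset.mem_Icc]
      exact and_congr_right fun _ => by norm_cast
    refine (exists_le_mul_pow_of_recursion
      (s := fun n => ((partLists (blockLengths d k) n).card : ℝ))
      (w := fun i => if i ∈ blockLengths d k then 1 else 0) h0 k.succ_pos
      (fun i => by positivity) hpos ?_ ?_).imp fun c h => ⟨h.1, _, h.2⟩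
    · intro n hn
      rw [card_partLists_eq_sum _ (by omega)]
      simp only [ite_mul, one_mul, zero_mul, ← Finset.sum_filter]
      refine Finset.sum_le_sum_of_subset_of_nonneg ?_ fun _ _ _ => Nat.cast_nonneg _
      refine Finset.filter_subset_filter _ (Finset.Icc_subset_Icc_right ?_)
      omega
    · simp only [ite_mul, one_mul, zero_mul, ← Finset.sum_filter]
      refine HasSum.unique ?_ hs
      have h2 : (Finset.Icc 1 (k + 1)).filter (· ∈ blockLengths d k) =
          Finset.Icc (d + 1) (k + 1) := by
        ext i
        simp only [Finset.mem_filter, hmem, Finset.mem_Icc]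
        omega
      have h3 : blockLengths d k = ((Finset.Icc (d + 1) (k + 1) : Finset ℕ) : Set ℕ) :=
        Set.ext hmem
      rw [h2, h3]
      exact Finset.hasSum _ _

/-! ### Bounds for the optimal code size -/

theorem exists_le_optimalCodeSize_mul {d : ℕ} {k : ℕ∞} (hdk : (d : ℕ∞) < k) (t : ℕ) {ρ : ℝ}
    (h0 : 0 < ρ) (hs : HasSum (fun i : blockLengths d k => ρ ^ (i : ℕ)) 1) :
    ∃ c > 0, ∀ᶠ n : ℕ in atTop, c ≤ (optimalCodeSize d k n t : ℝ) * ρ ^ n * (n : ℝ) ^ t := by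
  obtain ⟨c, hc, N, h⟩ := exists_le_card_partLists_mul_pow hdk h0 hs
  refine ⟨c / 2 ^ t, by positivity, ?_⟩
  filter_upwards [eventually_ge_atTop N, eventually_gt_atTop 0] with n hn hn0
  obtain ⟨p, hp, hnp, hp2⟩ := Nat.exists_prime_lt_and_le_two_mul n hn0.ne'
  have h1 : ((partLists (blockLengths d k) n).card : ℝ) ≤
      (optimalCodeSize d k n t : ℝ) * (p : ℝ) ^ t := by
    exact_mod_cast card_partLists_le d k n t p hp hnp
  have h2 : (p : ℝ) ≤ 2 * n := by exact_mod_cast hp2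
  rw [div_le_iff₀ (by positivity)]
  calc c ≤ _ := h n hn
    _ ≤ (optimalCodeSize d k n t : ℝ) * (p : ℝ) ^ t * ρ ^ n := by gcongr
    _ ≤ (optimalCodeSize d k n t : ℝ) * (2 * n : ℝ) ^ t * ρ ^ n := by gcongr
    _ = _ := by rw [mul_pow]; ring

theorem exists_card_filter_ascents_le {d : ℕ} {k : ℕ∞} (hdk : (d : ℕ∞) < k) {ρ : ℝ}
    (h0 : 0 < ρ) (hs : HasSum (fun i : blockLengths d k => ρ ^ (i : ℕ)) 1) :
    ∃ q > 0, ∃ B > 0, ∃ β : ℝ, 0 < β ∧ β < 1 ∧ ∀ n : ℕ,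
      (((partLists (blockLengths d k) n).filter fun l => ascents (d + 1) l < n / q).card : ℝ) *
        ρ ^ n ≤ B * β ^ (n / q) := by
  obtain ⟨ha, ha'⟩ := mem_blockLengths_of_lt hdk
  have h1 := lt_one_of_hasSum_pow ha ha' h0 hs
  obtain ⟨x, hx, hx1, hx2⟩ := exists_gt_sq_tsum_lt_one (2 * (d + 1) + 1) h0 h1 hs.tsum_eq
  have hx0 := h0.trans hx
  obtain ⟨θ, hθ, hθ1⟩ := exists_between hx2
  have hτ0 : 0 < ρ / x := div_pos h0 hx0
  have hτ : ρ / x < 1 := (div_lt_one hx0).2 hx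
  -- This `q` makes `β = 2 (ρ / x) ^ q` less than 1, absorbing the factor `2 ^ (n / q)` from
  -- Markov's inequality.
  obtain ⟨q, hq⟩ := exists_pow_lt_of_lt_one (show (0 : ℝ) < 1 / 2 by norm_num) hτ
  have hq0 : 0 < q := by
    rcases Nat.eq_zero_or_pos q with rfl | h
    · norm_num at hq
    · exact h
  refine ⟨q, hq0, 1 / (1 - θ), one_div_pos.2 (sub_pos.2 hθ1), 2 * (ρ / x) ^ q, by positivity,
    by linarith, fun n => ?_⟩
  have hA := sum_ascents_mul_pow_le ha ha' hx0 hx1 hθ1 hθ.le n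
  have hB : 0 ≤ 1 / (1 - θ) := (one_div_pos.2 (sub_pos.2 hθ1)).le
  calc _ ≤ (2 ^ (n / q) * ∑ l ∈ partLists (blockLengths d k) n,
        (1 / 2 : ℝ) ^ ascents (d + 1) l) * ρ ^ n := by
        gcongr
        exact card_filter_ascents_lt_le _ _ _ _
    _ = 2 ^ (n / q) * ((∑ l ∈ partLists (blockLengths d k) n,
        (1 / 2 : ℝ) ^ ascents (d + 1) l) * x ^ n) * (ρ / x) ^ n := by
        rw [div_pow]
        field_simp
    _ ≤ 2 ^ (n / q) * (1 / (1 - θ)) * (ρ / x) ^ (q * (n / q)) := by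
        refine mul_le_mul (mul_le_mul_of_nonneg_left hA (by positivity))
          (pow_le_pow_of_le_one hτ0.le hτ.le (Nat.mul_div_le n q)) (by positivity) (by positivity)
    _ = _ := by
        rw [mul_pow, pow_mul]
        ring

theorem exists_optimalCodeSize_mul_le {d : ℕ} {k : ℕ∞} (hdk : (d : ℕ∞) < k) (t : ℕ) {ρ : ℝ}
    (h0 : 0 < ρ) (hs : HasSum (fun i : blockLengths d k => ρ ^ (i : ℕ)) 1) :
    ∃ c > 0, ∀ᶠ n : ℕ in atTop, (optimalCodeSize d k n t : ℝ) * ρ ^ n * (n : ℝ) ^ t ≤ c := by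
  obtain ⟨ha, ha'⟩ := mem_blockLengths_of_lt hdk
  have h1 := lt_one_of_hasSum_pow ha ha' h0 hs
  obtain ⟨q, hq, B, hB, β, hβ0, hβ1, hfew⟩ := exists_card_filter_ascents_le hdk h0 hs
  -- Exponential decay beats `m ^ t`, so the words with few ascents contribute a bounded amount.
  obtain ⟨D, hD⟩ := (tendsto_pow_const_mul_const_pow_of_lt_one t hβ0.le hβ1).bddAbove_range
  have hD : ∀ m : ℕ, (m : ℝ) ^ t * β ^ m ≤ D := fun m => hD ⟨m, rfl⟩
  have hD0 : 0 ≤ D := (by positivity : (0 : ℝ) ≤ ((0 : ℕ) : ℝ) ^ t * β ^ 0).trans (hD 0)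
  refine ⟨(B * D + 2 ^ t * t.factorial) * (2 * q) ^ t, by positivity, ?_⟩
  filter_upwards [eventually_ge_atTop (q * (2 * t + 1))] with n hn
  set m := n / q with hm
  have hm1 : 2 * t + 1 ≤ m := (Nat.le_div_iff_mul_le hq).2 (by rwa [mul_comm])
  have hm0 : (0 : ℝ) < m := Nat.cast_pos.2 (by omega)
  have hnm : (n : ℝ) ≤ m * (2 * q) := by
    have h2 := Nat.div_add_mod n q
    have h3 := Nat.mod_lt n hq
    have h4 : n ≤ m * (2 * q) := by
      rw [← hm] at h2
      nlinarith [Nat.mul_le_mul_left q (by omega : 1 ≤ m)]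
    exact_mod_cast h4
  -- For `m ≥ 2 t + 1` each factor of the falling factorial is at least `m / 2`.
  have hch : (m : ℝ) ^ t ≤ 2 ^ t * t.factorial * (m.choose t : ℝ) := by
    have h2 := Nat.pow_le_choose (α := ℝ) t m
    rw [div_le_iff₀ (by positivity)] at h2
    have h3 : (m : ℝ) ≤ 2 * (m + 1 - t : ℕ) := by
      have : m ≤ 2 * (m + 1 - t) := by omega
      exact_mod_cast this
    calc (m : ℝ) ^ t ≤ (2 * (m + 1 - t : ℕ)) ^ t := by gcongr
      _ = 2 ^ t * ((m + 1 - t : ℕ) : ℝ) ^ t := mul_pow _ _ _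
      _ ≤ 2 ^ t * (m.choose t * t.factorial) := by gcongr
      _ = _ := by ring
  have hchpos : (0 : ℝ) < m.choose t := Nat.cast_pos.2 (Nat.choose_pos (by omega))
  have hpack : (optimalCodeSize d k n t : ℝ) * m.choose t ≤
      (((partLists (blockLengths d k) n).filter fun l => ascents (d + 1) l < m).card : ℝ) *
        m.choose t + (partLists (blockLengths d k) n).card := by
    exact_mod_cast optimalCodeSize_mul_choose_le d k n t (d + 1) m
  have hall := card_partLists_mul_pow_le h0 h1 hs.tsum_eq.le n
  have h2 : (optimalCodeSize d k n t : ℝ) * ρ ^ n ≤ B * β ^ m + 1 / m.choose t := by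
    rw [← mul_le_mul_iff_left₀ hchpos, add_mul, one_div, inv_mul_cancel₀ hchpos.ne']
    calc _ = (optimalCodeSize d k n t : ℝ) * m.choose t * ρ ^ n := by ring
      _ ≤ _ := mul_le_mul_of_nonneg_right hpack (by positivity)
      _ = (((partLists (blockLengths d k) n).filter fun l =>
            ascents (d + 1) l < m).card : ℝ) * ρ ^ n * m.choose t +
            (partLists (blockLengths d k) n).card * ρ ^ n := by ring
      _ ≤ _ := add_le_add (mul_le_mul_of_nonneg_right (hfew n) hchpos.le) hall
  have h3 : (B * β ^ m + 1 / m.choose t) * (m : ℝ) ^ t ≤ B * D + 2 ^ t * t.factorial := by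
    rw [add_mul]
    refine add_le_add ?_ ?_
    · rw [mul_assoc, mul_comm (β ^ m)]
      exact mul_le_mul_of_nonneg_left (hD m) hB.le
    · rw [one_div_mul_eq_div, div_le_iff₀ hchpos]
      exact hch
  calc _ ≤ (optimalCodeSize d k n t : ℝ) * ρ ^ n * (m * (2 * q)) ^ t := by gcongr
    _ = (optimalCodeSize d k n t : ℝ) * ρ ^ n * (m : ℝ) ^ t * (2 * q) ^ t := by
        rw [mul_pow]
        ring
    _ ≤ _ := by
        gcongr
        exact (mul_le_mul_of_nonneg_right h2 (by positivity)).trans h3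

theorem corollary1 (d : ℕ) (k : ℕ∞) (hdk : (d : ℕ∞) < k) (t : ℕ) (ht : 1 ≤ t) :
    ∃ ρ : ℝ, IsCharRoot d k ρ ∧ (∀ x : ℝ, IsCharRoot d k x → x = ρ) ∧
      (fun n : ℕ => Real.logb 2 (optimalCodeSize d k n t : ℝ) -
          (-(n : ℝ) * Real.logb 2 ρ - (t : ℝ) * Real.logb 2 (n : ℝ)))
        =O[atTop] (fun _ : ℕ => (1 : ℝ)) := by
  obtain ⟨ha, ha'⟩ := mem_blockLengths_of_lt hdk
  obtain ⟨ρ, h0, hs⟩ := exists_hasSum_pow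
    (fun h => (pos_of_mem_blockLengths (d := d) (k := k) h).false) ha ha'
  refine ⟨ρ, ⟨h0, hs⟩, fun x hx => eq_of_hasSum_pow ha d.succ_pos hx.1 h0 hx.2 hs, ?_⟩
  obtain ⟨c, hc, hlow⟩ := exists_le_optimalCodeSize_mul hdk t h0 hs
  obtain ⟨C, hC, hup⟩ := exists_optimalCodeSize_mul_le hdk t h0 hs
  refine IsBigO.of_bound (max |Real.logb 2 c| |Real.logb 2 C|) ?_
  filter_upwards [hlow, hup, eventually_gt_atTop 0] with n h1 h2 hn
  have hn : (0 : ℝ) < n := Nat.cast_pos.2 hn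
  have hM : (optimalCodeSize d k n t : ℝ) ≠ 0 := by
    intro h
    rw [h, zero_mul, zero_mul] at h1
    exact h1.not_gt hc
  -- The error term is the logarithm of the normalised code size, which lies between `c` and `C`.
  have hlog : Real.logb 2 (optimalCodeSize d k n t : ℝ) -
      (-(n : ℝ) * Real.logb 2 ρ - (t : ℝ) * Real.logb 2 (n : ℝ)) =
      Real.logb 2 ((optimalCodeSize d k n t : ℝ) * ρ ^ n * (n : ℝ) ^ t) := by
    rw [Real.logb_mul (mul_ne_zero hM (pow_pos h0 n).ne') (pow_pos hn t).ne',
      Real.logb_mul hM (pow_pos h0 n).ne', Real.logb_pow, Real.logb_pow]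
    ring
  rw [hlog, norm_one, mul_one, Real.norm_eq_abs]
  exact abs_le_max_abs_abs (Real.logb_le_logb_of_le one_lt_two hc h1)
    (Real.logb_le_logb_of_le one_lt_two (hc.trans_le h1) h2)
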